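/- For $k\ge 0$ and a set $A\subset\mathbb R^d$ contained in a $k$-dimensional affine subspace, let $|A|$ denote its $k$-dimensional volume, i.e. its $k$-dimensional Lebesgue measure within such a subspace (equivalently, its $k$-dimensional Hausdorff measure, normalized to agree with Lebesgue measure on $\mathbb R^k$). Let $d\ge 1$ and $l\in\{1,\dots,d\}$, let $X_0,X_1,\dots,X_l$ be independent standard Gaussian random vectors in $\mathbb R^d$, and let $\sigma_0,\dots,\sigma_l>0$. Denote by $|\mathrm{conv}(\sigma_0X_0,\dots,\sigma_lX_l)|$ the $l$-dimensional volume of the convex hull of the points $\sigma_0X_0,\dots,\sigma_lX_l$. Then for every real $p>0$ the random variable $|\mathrm{conv}(\sigma_0X_0,\dots,\sigma_lX_l)|$ is finite, its $p$-th moment is finite, and $$ \mathbb E\,|\mathrm{conv}(\sigma_0 X_0,\dots,\sigma_l X_l)|^p =\left[\frac{2^{l/2}\,\sigma_0\cdots\sigma_l}{l!}\sqrt{\frac1{\sigma_0^2}+\dots+\frac1{\sigma_l^2}}\,\right]^p \prod_{i=d-l+1}^{d}\frac{\Gamma\big(\frac{i+p}{2}\big)}{\Gamma\big(\frac{i}{2}\big)}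 . $$ -/

import Mathlib

open MeasureTheory ProbabilityTheory
open scoped Nat

/-- The simplex of points with nonnegative coordinates whose sum is at most `s`. -/
def cornerSimplex (n : ℕ) (s : ℝ) : Set (Fin n → ℝ) := {x | (∀ i, 0 ≤ x i) ∧ ∑ i, x i ≤ s}

lemma measurableSet_cornerSimplex (n : ℕ) (s : ℝ) : MeasurableSet (cornerSimplex n s) := by
  have : IsClosed (cornerSimplex n s) := by
    have h : cornerSimplex n s = (⋂ i, {x | 0 ≤ x i}) ∩ {x | ∑ i, x i ≤ s} := by
      ext x; simp [cornerSimplex]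
    rw [h]
    exact (isClosed_iInter fun i => isClosed_le (by fun_prop) (by fun_prop)).inter
      (isClosed_le (by fun_prop) (by fun_prop))
  exact this.measurableSet

lemma integral_sub_pow_div_factorial (n : ℕ) (s : ℝ) :
    ∫ t in (0 : ℝ)..s, (s - t) ^ n / (n ! : ℝ) = s ^ (n + 1) / ((n + 1)! : ℝ) := by
  rw [intervalIntegral.integral_comp_sub_left (fun t => t ^ n / (n ! : ℝ))]
  simp only [sub_self, sub_zero, intervalIntegral.integral_div, integral_pow]
  rw [Nat.factorial_succ]
  push_cast
  field_simp
  simp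

lemma volume_cornerSimplex (n : ℕ) : ∀ s : ℝ, 0 ≤ s →
    volume (cornerSimplex n s) = ENNReal.ofReal (s ^ n / (n ! : ℝ)) := by
  induction n with
  | zero =>
    intro s hs
    have : cornerSimplex 0 s = Set.univ := by
      ext x; simp [cornerSimplex, hs]
    simp [this, volume_pi]
  | succ n ih =>
    intro s hs
    have hmp := (volume_preserving_piFinSuccAbove (fun _ : Fin (n + 1) => ℝ) 0).symm
    rw [← hmp.measure_preimage_equiv, Measure.volume_eq_prod,
      Measure.prod_apply (hmp.measurable (measurableSet_cornerSimplex _ _))]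
    have hslice : ∀ t : ℝ, volume (Prod.mk t ⁻¹'
        ((MeasurableEquiv.piFinSuccAbove (fun _ : Fin (n + 1) => ℝ) 0).symm ⁻¹'
          cornerSimplex (n + 1) s)) =
        (Set.Icc 0 s).indicator (fun t => ENNReal.ofReal ((s - t) ^ n / (n ! : ℝ))) t := by
      intro t
      by_cases ht : t ∈ Set.Icc 0 s
      · rw [Set.indicator_of_mem ht, ← ih (s - t) (by linarith [ht.2])]
        congr 1
        ext y
        simp [cornerSimplex, Fin.forall_fin_succ, Fin.sum_univ_succ, ht.1, le_sub_iff_add_le',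
          MeasurableEquiv.piFinSuccAbove, Fin.insertNthEquiv]
      · rw [Set.indicator_of_notMem ht]
        convert measure_empty (μ := (volume : Measure (Fin n → ℝ)))
        ext y
        simp only [cornerSimplex, MeasurableEquiv.piFinSuccAbove, Set.mem_preimage,
          Set.mem_empty_iff_false, iff_false]
        rintro ⟨h0, h1⟩
        rw [Fin.sum_univ_succ] at h1
        simp only [Fin.forall_fin_succ] at h0
        simp [Fin.insertNthEquiv] at h0 h1
        have := Finset.sum_nonneg (fun i (_ : i ∈ Finset.univ) => h0.2 i)
        exact ht ⟨h0.1, by linarith⟩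
    simp_rw [hslice]
    rw [lintegral_indicator measurableSet_Icc, ← integral_sub_pow_div_factorial,
      intervalIntegral.integral_of_le hs, ← integral_Icc_eq_integral_Ioc,
      ofReal_integral_eq_lintegral_ofReal]
    · exact (Continuous.integrableOn_Icc (by fun_prop))
    · refine (ae_restrict_iff' measurableSet_Icc).2 (.of_forall fun t ht => ?_)
      have : 0 ≤ s - t := by linarith [ht.2]
      positivity

lemma convexHull_range_eq_image_stdSimplex {E ι : Type*} [AddCommGroup E] [Module ℝ E] [Fintype ι]
    (y : ι → E) :
    convexHull ℝ (Set.range y) = (fun w : ι → ℝ => ∑ i, w i • y i) '' stdSimplex ℝ ι := by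
  classical
  have h := (Fintype.linearCombination ℝ y).image_convexHull (Set.range fun i : ι => Pi.single i 1)
  rw [convexHull_rangle_single_eq_stdSimplex, ← Set.range_comp] at h
  have hy : (Fintype.linearCombination ℝ y) ∘ (fun i : ι => Pi.single i (1 : ℝ)) = y := by
    funext i
    simp [Fintype.linearCombination_apply_single]
  rw [hy] at h
  rw [← h]
  exact Set.image_congr fun w _ => Fintype.linearCombination_apply ℝ y w

lemma convexHull_range_eq_image_cornerSimplex {E : Type*} [AddCommGroup E] [Module ℝ E] {n : ℕ}
    (y : Fin (n + 1) → E) :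
    convexHull ℝ (Set.range y) =
      (fun w : Fin n → ℝ => y 0 + ∑ i, w i • (y i.succ - y 0)) '' cornerSimplex n 1 := by
  have key : ∀ w : Fin n → ℝ, y 0 + ∑ i, w i • (y i.succ - y 0) =
      (1 - ∑ i, w i) • y 0 + ∑ i, w i • y i.succ := by
    intro w
    simp only [smul_sub, Finset.sum_sub_distrib, ← Finset.sum_smul]
    module
  rw [convexHull_range_eq_image_stdSimplex]
  ext x
  simp only [Set.mem_image]
  constructor
  · rintro ⟨w, ⟨h0, h1⟩, rfl⟩
    rw [Fin.sum_univ_succ] at h1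
    refine ⟨fun i => w i.succ, ⟨fun i => h0 _, by linarith [h0 0]⟩, ?_⟩
    rw [key, Fin.sum_univ_succ, ← h1]
    simp
  · rintro ⟨w, ⟨h0, h1⟩, rfl⟩
    refine ⟨Fin.cons (1 - ∑ i, w i) w, ⟨?_, ?_⟩, ?_⟩
    · intro i
      cases i using Fin.cases with
      | zero => simpa using h1
      | succ i => simpa using h0 i
    · simp [Fin.sum_univ_succ]
    · simp [key, Fin.sum_univ_succ]

/-- The volume of a simplex in terms of the Gram determinant of its edges at one vertex. -/
lemma euclideanHausdorffMeasure_convexHull_range {E : Type*} [NormedAddCommGroup E]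
    [InnerProductSpace ℝ E] [MeasurableSpace E] [BorelSpace E] {n : ℕ} (y : Fin (n + 1) → E) :
    μHE[n] (convexHull ℝ (Set.range y)) =
      ENNReal.ofReal (√(Matrix.gram ℝ fun i : Fin n => y i.succ - y 0).det / (n ! : ℝ)) := by
  let f : EuclideanSpace ℝ (Fin n) →ₗ[ℝ] E :=
    (Fintype.linearCombination ℝ fun i : Fin n => y i.succ - y 0) ∘ₗ
      (WithLp.linearEquiv 2 ℝ (Fin n → ℝ)).toLinearMap
  have himage : convexHull ℝ (Set.range y) =
      (IsometryEquiv.addLeft (y 0)) '' (f '' (WithLp.toLp 2 '' cornerSimplex n 1)) := by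
    rw [convexHull_range_eq_image_cornerSimplex, Set.image_image, Set.image_image]
    simp [f, Fintype.linearCombination_apply]
  have hdet : f.normDet = √(Matrix.gram ℝ fun i : Fin n => y i.succ - y 0).det := by
    have h := f.normDet_sq_eq_det_gram (EuclideanSpace.basisFun (Fin n) ℝ)
    have hb : (fun i => f (EuclideanSpace.basisFun (Fin n) ℝ i)) = fun i => y i.succ - y 0 := by
      ext i
      simp [f, Fintype.linearCombination_apply_single]
    rw [hb] at h
    rw [← h]
    exact (Real.sqrt_sq f.normDet_nonneg).symm
  have hvol : volume (WithLp.toLp 2 '' cornerSimplex n 1) = ENNReal.ofReal (1 / (n ! : ℝ)) := by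
    have hmp := EuclideanSpace.volume_preserving_symm_measurableEquiv_toLp (Fin n)
    have h := volume_cornerSimplex n 1 zero_le_one
    rw [one_pow, ← hmp.measure_preimage_equiv] at h
    rw [← h, MeasurableEquiv.preimage_symm]
    rfl
  rw [himage, (IsometryEquiv.isometry _).euclideanHausdorffMeasure_image]
  have h := f.euclideanHausdorffMeasure_image_eq_normDet_mul_volume (WithLp.toLp 2 '' cornerSimplex n 1)
  rw [finrank_euclideanSpace_fin] at h
  rw [h, hdet, hvol, ← ENNReal.ofReal_mul (Real.sqrt_nonneg _), mul_one_div]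

section GaussianVector

open Real

variable {E : Type*} [NormedAddCommGroup E] [InnerProductSpace ℝ E] [FiniteDimensional ℝ E]
  [MeasurableSpace E] [BorelSpace E]

lemma integrable_exp_neg_norm_sq_div_two : Integrable fun x : E => exp (-(1 / 2) * ‖x‖ ^ 2) := by
  by_contra h
  have h1 := integral_undef h
  rw [GaussianFourier.integral_rexp_neg_mul_sq_norm (by norm_num)] at h1
  have : 0 < (π / (1 / 2)) ^ (Module.finrank ℝ E / 2 : ℝ) := by positivity
  exact this.ne' h1

variable (E) in
/-- The density of the standard Gaussian measure with respect to the Lebesgue measure. -/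
lemma stdGaussian_eq_withDensity :
    stdGaussian E = (volume : Measure E).withDensity fun x =>
      ENNReal.ofReal ((∫ y : E, exp (-(1 / 2) * ‖y‖ ^ 2))⁻¹ * exp (-(1 / 2) * ‖x‖ ^ 2)) := by
  set c := ∫ y : E, exp (-(1 / 2) * ‖y‖ ^ 2) with hc
  have hcpos : 0 < c := by
    rw [hc, GaussianFourier.integral_rexp_neg_mul_sq_norm (by norm_num)]; positivity
  have : IsFiniteMeasure ((volume : Measure E).withDensity fun x =>
      ENNReal.ofReal (c⁻¹ * exp (-(1 / 2) * ‖x‖ ^ 2))) :=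
    isFiniteMeasure_withDensity_ofReal
      (integrable_exp_neg_norm_sq_div_two.const_mul c⁻¹).2
  refine Measure.ext_of_charFun ?_
  ext t
  rw [charFun_stdGaussian, charFun_apply, integral_withDensity_eq_integral_toReal_smul
    (by fun_prop) (by simp)]
  have h1 : ∀ x : E, (ENNReal.ofReal (c⁻¹ * exp (-(1 / 2) * ‖x‖ ^ 2))).toReal •
      Complex.exp (inner ℝ x t * Complex.I) = (c : ℂ)⁻¹ *
        Complex.exp (-(1 / 2 : ℂ) * ‖x‖ ^ 2 + Complex.I * inner ℝ t x) := by
    intro x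
    rw [ENNReal.toReal_ofReal (by positivity), Complex.exp_add, real_inner_comm, Complex.real_smul]
    push_cast
    ring_nf
  simp_rw [h1]
  have hcC : (c : ℂ) = (π / (1 / 2 : ℂ)) ^ (Module.finrank ℝ E / 2 : ℂ) := by
    rw [hc, GaussianFourier.integral_rexp_neg_mul_sq_norm (by norm_num),
      Complex.ofReal_cpow (by positivity)]
    push_cast
    rfl
  rw [integral_const_mul, GaussianFourier.integral_cexp_neg_mul_sq_norm_add (by norm_num), ← hcC,
    inv_mul_cancel_left₀ (by exact_mod_cast hcpos.ne')]
  congr 1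
  rw [Complex.I_sq]
  ring

lemma stdGaussian_singleton [Nontrivial E] (x : E) : stdGaussian E {x} = 0 := by
  rw [stdGaussian_eq_withDensity]
  exact withDensity_absolutelyContinuous _ _ (measure_singleton x)

lemma integral_pow_mul_exp_neg_sq_div_two_mul_rpow (n : ℕ) (hn : 1 ≤ n) (p : ℝ) (hp : 0 ≤ p) :
    ∫ y in Set.Ioi (0 : ℝ), y ^ (n - 1) * (exp (-(1 / 2) * y ^ 2) * y ^ p) =
      2 ^ (((n : ℝ) + p) / 2) * (1 / 2) * Gamma (((n : ℝ) + p) / 2) := by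
  have h := integral_rpow_mul_exp_neg_mul_rpow (p := 2) (q := n - 1 + p) (b := 1 / 2)
    (by norm_num) (by have : (1 : ℝ) ≤ n := by exact_mod_cast hn
                      linarith) (by norm_num)
  rw [show (n : ℝ) - 1 + p + 1 = n + p by ring] at h
  rw [one_div, inv_rpow (by norm_num), ← rpow_neg (by norm_num), neg_div, neg_neg, ← one_div] at h
  rw [← h]
  refine setIntegral_congr_fun measurableSet_Ioi fun y (hy : 0 < y) => ?_
  have : y ^ (n - 1) = y ^ ((n : ℝ) - 1) := by
    rw [← rpow_natCast, Nat.cast_sub hn, Nat.cast_one]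
  simp only [this, rpow_add hy, rpow_two]
  ring

/-- The moments of the norm of a standard Gaussian vector. -/
lemma lintegral_norm_rpow_stdGaussian [Nontrivial E] (p : ℝ) (hp : 0 < p) :
    ∫⁻ x : E, ENNReal.ofReal (‖x‖ ^ p) ∂stdGaussian E =
      ENNReal.ofReal (2 ^ (p / 2) * (Gamma (((Module.finrank ℝ E : ℝ) + p) / 2) /
        Gamma ((Module.finrank ℝ E : ℝ) / 2))) := by
  set n := Module.finrank ℝ E with hn
  have hn1 : 1 ≤ n := Module.finrank_pos
  set κ := (volume : Measure E).real (Metric.ball 0 1)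
  have hκ : 0 < κ := ENNReal.toReal_pos (Metric.measure_ball_pos _ _ one_pos).ne' measure_ball_lt_top.ne
  have hnpos : (0 : ℝ) < n := by exact_mod_cast hn1
  have hc : ∫ y : E, exp (-(1 / 2) * ‖y‖ ^ 2) =
      n * (κ * (2 ^ ((n : ℝ) / 2) * (1 / 2) * Gamma ((n : ℝ) / 2))) := by
    rw [integral_fun_norm_addHaar volume fun y => exp (-(1 / 2) * y ^ 2)]
    have := integral_pow_mul_exp_neg_sq_div_two_mul_rpow n hn1 0 le_rfl
    simp only [rpow_zero, mul_one, add_zero] at this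
    simp only [smul_eq_mul, ← hn]
    rw [this, nsmul_eq_mul]
  have hp' : ∫ y : E, exp (-(1 / 2) * ‖y‖ ^ 2) * ‖y‖ ^ p =
      n * (κ * (2 ^ (((n : ℝ) + p) / 2) * (1 / 2) * Gamma (((n : ℝ) + p) / 2))) := by
    rw [integral_fun_norm_addHaar volume fun y => exp (-(1 / 2) * y ^ 2) * y ^ p]
    have := integral_pow_mul_exp_neg_sq_div_two_mul_rpow n hn1 p hp.le
    simp only [smul_eq_mul, ← hn]
    rw [this, nsmul_eq_mul]
  have hG : 0 < Gamma ((n : ℝ) / 2) := Gamma_pos_of_pos (by positivity)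
  have hG' : 0 < Gamma (((n : ℝ) + p) / 2) := Gamma_pos_of_pos (by positivity)
  have hint : Integrable fun y : E => exp (-(1 / 2) * ‖y‖ ^ 2) * ‖y‖ ^ p := by
    by_contra h
    rw [integral_undef h] at hp'
    exact absurd hp' (by positivity)
  rw [stdGaussian_eq_withDensity, lintegral_withDensity_eq_lintegral_mul _ (by fun_prop)
    (by fun_prop)]
  set c := ∫ y : E, exp (-(1 / 2) * ‖y‖ ^ 2)
  have hcpos : 0 < c := by rw [hc]; positivity
  simp only [Pi.mul_apply]
  simp_rw [← ENNReal.ofReal_mul (mul_nonneg (inv_nonneg.2 hcpos.le) (exp_pos _).le), mul_assoc]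
  rw [← ofReal_integral_eq_lintegral_ofReal (hint.const_mul _)
    (.of_forall fun x => by positivity), integral_const_mul, hp', hc]
  congr 1
  rw [add_div, rpow_add (by norm_num)]
  field_simp

/-- Standard Gaussian measures are preserved by maps with isometric adjoint. -/
lemma stdGaussian_map_of_adjoint_isometry {F : Type*} [NormedAddCommGroup F]
    [InnerProductSpace ℝ F] [FiniteDimensional ℝ F] [MeasurableSpace F] [BorelSpace F]
    (f : E → F) (hf : Measurable f) (g : F → E) (hfg : ∀ x t, inner ℝ (f x) t = inner ℝ x (g t))
    (hg : ∀ t, ‖g t‖ = ‖t‖) :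
    (stdGaussian E).map f = stdGaussian F := by
  have : IsProbabilityMeasure ((stdGaussian E).map f) :=
    Measure.isProbabilityMeasure_map hf.aemeasurable
  refine Measure.ext_of_charFun ?_
  ext t
  rw [charFun_stdGaussian, charFun_apply, integral_map hf.aemeasurable
    (by fun_prop)]
  simp_rw [hfg]
  rw [← charFun_apply, charFun_stdGaussian, hg]

lemma map_orthogonalProjection_stdGaussian (K : Submodule ℝ E) :
    (stdGaussian E).map K.orthogonalProjectionOnto = stdGaussian K :=
  stdGaussian_map_of_adjoint_isometry _ (by fun_prop) (fun t => (t : E))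
    (fun x t => by simp) (fun t => by simp)

lemma map_toLp_pi_stdGaussian (ι : Type*) [Fintype ι] :
    (Measure.pi fun _ : ι => stdGaussian E).map (WithLp.toLp 2) =
      stdGaussian (PiLp 2 fun _ : ι => E) := by
  have : IsProbabilityMeasure ((Measure.pi fun _ : ι => stdGaussian E).map (WithLp.toLp 2)) :=
    Measure.isProbabilityMeasure_map (by fun_prop)
  refine Measure.ext_of_charFun ?_
  ext t
  rw [charFun_pi, charFun_stdGaussian, ← Complex.ofReal_pow, PiLp.norm_sq_eq_of_L2]
  simp_rw [charFun_stdGaussian, ← Complex.exp_sum]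
  push_cast
  rw [neg_div, Finset.sum_div, ← Finset.sum_neg_distrib]
  simp_rw [neg_div]

/-- Mixing independent standard Gaussian vectors by a matrix with orthonormal columns yields
independent standard Gaussian vectors. -/
lemma map_matrix_mix_pi_stdGaussian {ι κ : Type*} [Fintype ι] [Fintype κ] [DecidableEq κ]
    (Q : Matrix ι κ ℝ) (hQ : Q.transpose * Q = 1) :
    (Measure.pi fun _ : ι => stdGaussian E).map (fun v j => ∑ i, Q i j • v i) =
      Measure.pi fun _ : κ => stdGaussian E := by
  have hm : Measurable fun (v : PiLp 2 fun _ : ι => E) =>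
      (WithLp.toLp 2 (fun j => ∑ i, Q i j • v i) : PiLp 2 fun _ : κ => E) := by
    fun_prop
  have h := stdGaussian_map_of_adjoint_isometry (E := PiLp 2 fun _ : ι => E)
    (F := PiLp 2 fun _ : κ => E) (fun v => WithLp.toLp 2 (fun j => ∑ i, Q i j • v i)) hm
    (fun t => WithLp.toLp 2 (fun i => ∑ j, Q i j • t j)) ?_ ?_
  · rw [← map_toLp_pi_stdGaussian, ← map_toLp_pi_stdGaussian,
      Measure.map_map hm (by fun_prop)] at h
    refine (MeasurableEquiv.toLp 2 (κ → E)).map_measurableEquiv_injective ?_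
    rw [MeasurableEquiv.coe_toLp, ← h, Measure.map_map (by fun_prop) (by fun_prop)]
    rfl
  · intro x t
    simp only [PiLp.inner_apply, sum_inner, inner_sum, real_inner_smul_left,
      real_inner_smul_right]
    exact Finset.sum_comm
  · intro t
    rw [← sq_eq_sq₀ (norm_nonneg _) (norm_nonneg _), ← real_inner_self_eq_norm_sq,
      ← real_inner_self_eq_norm_sq]
    simp only [PiLp.inner_apply, sum_inner, inner_sum, real_inner_smul_left,
      real_inner_smul_right]
    rw [Finset.sum_comm]
    refine Finset.sum_congr rfl fun j _ => ?_
    rw [Finset.sum_comm]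
    have hQ' : ∀ k, ∑ i, Q i k * Q i j = (1 : Matrix κ κ ℝ) k j := fun k => by
      rw [← hQ]; simp [Matrix.mul_apply]
    simp_rw [← mul_assoc, ← Finset.sum_mul]
    simp_rw [mul_comm (Q _ j), hQ']
    simp [Matrix.one_apply]

end GaussianVector

section GramDeterminant

variable {E : Type*} [NormedAddCommGroup E] [InnerProductSpace ℝ E]

lemma inner_orthogonalProjectionOnto_orthogonal_span_singleton (g a b : E) :
    inner ℝ ((ℝ ∙ g)ᗮ.orthogonalProjectionOnto a) ((ℝ ∙ g)ᗮ.orthogonalProjectionOnto b) =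
      inner ℝ a b - inner ℝ a g * (‖g‖ ^ 2)⁻¹ * inner ℝ g b := by
  rw [Submodule.inner_orthogonalProjectionOnto_eq_of_mem_right,
    Submodule.coe_orthogonalProjectionOnto_apply, Submodule.starProjection_orthogonal_val,
    Submodule.starProjection_singleton, inner_sub_right, real_inner_smul_right]
  simp only [RCLike.ofReal_real_eq_id, id]
  ring

/-- Base times height for Gram determinants. -/
lemma det_gram_cons {n : ℕ} {g : E} (hg : g ≠ 0) (v : Fin n → E) :
    (Matrix.gram ℝ (Fin.cons g v : Fin (n + 1) → E)).det =
      ‖g‖ ^ 2 * (Matrix.gram ℝ fun i => (ℝ ∙ g)ᗮ.orthogonalProjectionOnto (v i)).det := by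
  have hg' : ‖g‖ ^ 2 ≠ 0 := by positivity
  let D : Matrix PUnit.{1} PUnit.{1} ℝ := Matrix.of fun _ _ => ‖g‖ ^ 2
  have hD : D * Matrix.of (fun _ _ => (‖g‖ ^ 2)⁻¹) = 1 := by
    ext i j; simp [D, Matrix.mul_apply, hg']
  have hD' : Matrix.of (fun _ _ => (‖g‖ ^ 2)⁻¹) * D = 1 := by
    ext i j; simp [D, Matrix.mul_apply, hg']
  let _ : Invertible D := ⟨_, hD', hD⟩
  let e := (finSuccEquiv n).trans (Equiv.optionEquivSumPUnit.{0} (Fin n))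
  rw [← Matrix.det_submatrix_equiv_self e.symm]
  have hblock : (Matrix.gram ℝ (Fin.cons g v : Fin (n + 1) → E)).submatrix e.symm e.symm =
      Matrix.fromBlocks (Matrix.gram ℝ v) (Matrix.of fun i _ => inner ℝ (v i) g)
        (Matrix.of fun _ j => inner ℝ g (v j)) D := by
    ext i j
    rcases i with i | i <;> rcases j with j | j <;>
      simp [e, Matrix.gram_apply, D]
  rw [hblock, Matrix.det_fromBlocks₂₂, Matrix.det_unique]
  refine congrArg (fun A : Matrix (Fin n) (Fin n) ℝ => ‖g‖ ^ 2 * A.det) ?_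
  ext i j
  rw [Matrix.gram_apply, inner_orthogonalProjectionOnto_orthogonal_span_singleton]
  simp [Matrix.mul_apply, Matrix.gram_apply, D]

lemma gram_sum_smul {ι κ : Type*} [Fintype ι] (M : Matrix ι κ ℝ) (w : ι → E) :
    Matrix.gram ℝ (fun j => ∑ i, M i j • w i) = M.transpose * Matrix.gram ℝ w * M := by
  ext a b
  simp only [Matrix.gram_apply, sum_inner, inner_sum, real_inner_smul_left, real_inner_smul_right,
    Matrix.mul_apply, Matrix.transpose_apply, Finset.sum_mul]
  exact Finset.sum_congr rfl fun _ _ => Finset.sum_congr rfl fun _ _ => by ring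

lemma continuous_det_gram {ι : Type*} [Fintype ι] [DecidableEq ι] :
    Continuous fun v : ι → E => (Matrix.gram ℝ v).det := by
  refine Continuous.matrix_det (continuous_matrix fun i j => ?_)
  simp only [Matrix.gram_apply]
  fun_prop

end GramDeterminant

/-- Moments of the volume of the parallelepiped spanned by independent standard Gaussian vectors. -/
theorem lintegral_sqrt_det_gram_rpow_pi_stdGaussian (p : ℝ) (hp : 0 < p) (l : ℕ) :
    ∀ (E : Type*) [NormedAddCommGroup E] [InnerProductSpace ℝ E] [FiniteDimensional ℝ E]
      [MeasurableSpace E] [BorelSpace E], l ≤ Module.finrank ℝ E →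
    ∫⁻ v : Fin l → E, ENNReal.ofReal (√(Matrix.gram ℝ v).det ^ p)
        ∂(Measure.pi fun _ => stdGaussian E) =
      ∏ i ∈ Finset.Icc (Module.finrank ℝ E - l + 1) (Module.finrank ℝ E),
        ENNReal.ofReal (2 ^ (p / 2) *
          (Real.Gamma (((i : ℝ) + p) / 2) / Real.Gamma ((i : ℝ) / 2))) := by
  induction l with
  | zero =>
    intro E _ _ _ _ _ _
    simp
  | succ l ih =>
    intro E _ _ _ _ _ hE
    have : Nontrivial E := Module.nontrivial_of_finrank_pos (R := ℝ) (by omega)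
    have hmp := (measurePreserving_piFinSuccAbove
      (fun _ : Fin (l + 1) => stdGaussian E) 0).symm
    have hmeas : ∀ n, Measurable fun v : Fin n → E =>
        ENNReal.ofReal (√(Matrix.gram ℝ v).det ^ p) := fun n =>
      ((continuous_det_gram.measurable.sqrt).pow_const p).ennreal_ofReal
    have hmeas' := (hmeas (l + 1)).comp hmp.measurable
    simp only [Function.comp_def] at hmeas'
    rw [← hmp.lintegral_comp (hmeas _), lintegral_prod _ hmeas'.aemeasurable]
    have hinner : ∀ g : E, g ≠ 0 → ∫⁻ v : Fin l → E, ENNReal.ofReal (√(Matrix.gram ℝ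
        ((MeasurableEquiv.piFinSuccAbove (fun _ : Fin (l + 1) => E) 0).symm (g, v))).det ^ p)
          ∂(Measure.pi fun _ => stdGaussian E) =
        ENNReal.ofReal (‖g‖ ^ p) *
          ∏ i ∈ Finset.Icc (Module.finrank ℝ E - 1 - l + 1) (Module.finrank ℝ E - 1),
            ENNReal.ofReal (2 ^ (p / 2) *
              (Real.Gamma (((i : ℝ) + p) / 2) / Real.Gamma ((i : ℝ) / 2))) := by
      intro g hg
      have hfin : Module.finrank ℝ (ℝ ∙ g)ᗮ = Module.finrank ℝ E - 1 := by
        have h1 := (ℝ ∙ g).finrank_add_finrank_orthogonal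
        rw [finrank_span_singleton hg] at h1
        omega
      have h2 := ih (ℝ ∙ g)ᗮ (by omega)
      rw [hfin] at h2
      have hP : Measurable fun x : E => (ℝ ∙ g)ᗮ.orthogonalProjectionOnto x := by fun_prop
      rw [← h2, ← map_orthogonalProjection_stdGaussian, ← Measure.pi_map_pi fun _ => hP.aemeasurable,
        lintegral_map (((continuous_det_gram.measurable.sqrt).pow_const p).ennreal_ofReal)
          (by fun_prop), ← lintegral_const_mul _ (by
            exact (((continuous_det_gram.measurable.sqrt).pow_const p).ennreal_ofReal).comp
              (measurable_pi_lambda _ fun i => hP.comp (measurable_pi_apply i)))]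
      refine lintegral_congr fun v => ?_
      rw [← ENNReal.ofReal_mul (by positivity), ← Real.mul_rpow (norm_nonneg _)
        (Real.sqrt_nonneg _)]
      have hcons : (MeasurableEquiv.piFinSuccAbove (fun _ : Fin (l + 1) => E) 0).symm (g, v) =
          Fin.cons g v := by
        ext i
        simp [MeasurableEquiv.piFinSuccAbove, Fin.insertNthEquiv]
      rw [hcons, det_gram_cons hg, Real.sqrt_mul (by positivity), Real.sqrt_sq (norm_nonneg _)]
    have hae : ∀ᵐ g ∂stdGaussian E, g ≠ 0 := by
      simp [ae_iff, stdGaussian_singleton]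
    rw [lintegral_congr_ae (hae.mono fun g hg => hinner g hg),
      lintegral_mul_const _ (by fun_prop), lintegral_norm_rpow_stdGaussian p hp, mul_comm]
    obtain ⟨m, hm⟩ : ∃ m, Module.finrank ℝ E = m + 1 := ⟨Module.finrank ℝ E - 1, by omega⟩
    rw [hm, Nat.add_sub_cancel, Nat.add_sub_add_right,
      ← Finset.insert_Icc_right_eq_Icc_add_one (by omega), Finset.prod_insert (by simp), mul_comm]

lemma exists_sq_eq_transpose_mul_self {ι κ : Type*} [Fintype ι] [Fintype κ] [DecidableEq κ]
    (B : Matrix ι κ ℝ) : ∃ S : Matrix κ κ ℝ, S.transpose = S ∧ S * S = B.transpose * B := by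
  open scoped MatrixOrder in
  have hB : (B.transpose * B).PosSemidef := by
    simpa using Matrix.posSemidef_conjTranspose_mul_self B
  have hS : (CFC.sqrt (B.transpose * B)).PosSemidef :=
    Matrix.nonneg_iff_posSemidef.1 (CFC.sqrt_nonneg _)
  exact ⟨_, by simpa using hS.isHermitian.eq,
    CFC.sqrt_mul_sqrt_self _ (Matrix.nonneg_iff_posSemidef.2 hB)⟩

/-- Linear mixing of independent standard Gaussian vectors scales the law of the Gram determinant
by the Gram determinant of the mixing matrix. -/
lemma lintegral_det_gram_sum_smul_pi_stdGaussian {E : Type*} [NormedAddCommGroup E]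
    [InnerProductSpace ℝ E] [FiniteDimensional ℝ E] [MeasurableSpace E] [BorelSpace E]
    {ι κ : Type*} [Fintype ι] [Fintype κ] [DecidableEq κ] (B : Matrix ι κ ℝ)
    (hB : (B.transpose * B).det ≠ 0) {F : ℝ → ENNReal} (hF : Measurable F) :
    ∫⁻ v : ι → E, F (Matrix.gram ℝ fun j => ∑ i, B i j • v i).det
        ∂(Measure.pi fun _ => stdGaussian E) =
      ∫⁻ w : κ → E, F ((B.transpose * B).det * (Matrix.gram ℝ w).det)
        ∂(Measure.pi fun _ => stdGaussian E) := by
  obtain ⟨S, hST, hSS⟩ := exists_sq_eq_transpose_mul_self B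
  have hS : IsUnit S.det := by
    rw [← hSS, Matrix.det_mul] at hB
    exact isUnit_iff_ne_zero.2 (left_ne_zero_of_mul hB)
  have hQ : (B * S⁻¹).transpose * (B * S⁻¹) = 1 := by
    rw [Matrix.transpose_mul, Matrix.transpose_nonsing_inv, hST, Matrix.mul_assoc,
      ← Matrix.mul_assoc B.transpose, ← hSS, Matrix.mul_assoc, Matrix.mul_nonsing_inv _ hS,
      Matrix.mul_one, Matrix.nonsing_inv_mul _ hS]
  have hmeas : Measurable fun w : κ → E => F ((B.transpose * B).det * (Matrix.gram ℝ w).det) :=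
    hF.comp (continuous_const.mul continuous_det_gram).measurable
  rw [← map_matrix_mix_pi_stdGaussian (B * S⁻¹) hQ, lintegral_map hmeas (by fun_prop)]
  refine lintegral_congr fun v => ?_
  congr 1
  rw [gram_sum_smul, gram_sum_smul, ← hSS, ← Matrix.det_mul_comm]
  have hBQ : B = B * S⁻¹ * S := (Matrix.nonsing_inv_mul_cancel_right _ _ hS).symm
  conv_lhs => rw [hBQ, Matrix.transpose_mul]
  simp only [Matrix.det_mul, ← Matrix.mul_assoc, hST]
  rw [Matrix.mul_assoc S, Matrix.mul_assoc S]
  simp only [Matrix.det_mul]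
  ring

/-- The matrix mixing weighted points into the edges at the first vertex of their simplex. -/
def edgeMatrix {n : ℕ} (σ : Fin (n + 1) → ℝ) : Matrix (Fin (n + 1)) (Fin n) ℝ :=
  Matrix.of (Fin.cons (fun _ => -σ 0) fun i j => if i = j then σ j.succ else 0)

lemma sum_edgeMatrix_smul {E : Type*} [AddCommGroup E] [Module ℝ E] {n : ℕ}
    (σ : Fin (n + 1) → ℝ) (x : Fin (n + 1) → E) (j : Fin n) :
    ∑ i, edgeMatrix σ i j • x i = σ j.succ • x j.succ - σ 0 • x 0 := by
  simp [edgeMatrix, Fin.sum_univ_succ, ite_smul]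
  abel

lemma det_transpose_mul_edgeMatrix {n : ℕ} (σ : Fin (n + 1) → ℝ) (hσ : ∀ i, 0 < σ i) :
    ((edgeMatrix σ).transpose * edgeMatrix σ).det = (∏ i, σ i) ^ 2 * ∑ i, 1 / σ i ^ 2 := by
  have hσ0 : ∀ i, σ i ≠ 0 := fun i => (hσ i).ne'
  have h : (edgeMatrix σ).transpose * edgeMatrix σ =
      Matrix.diagonal (fun j : Fin n => σ j.succ ^ 2) +
        Matrix.replicateCol Unit (fun _ => σ 0) * Matrix.replicateRow Unit fun _ => σ 0 := by
    ext i j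
    by_cases hij : i = j
    · subst hij
      simp [edgeMatrix, Matrix.mul_apply, Fin.sum_univ_succ]
      ring
    · simp [edgeMatrix, Matrix.mul_apply, Fin.sum_univ_succ, hij, Ne.symm hij]
  have hdet : (Matrix.diagonal (fun j : Fin n => σ j.succ ^ 2)).det =
      (∏ j : Fin n, σ j.succ) ^ 2 := by
    rw [Matrix.det_diagonal, Finset.prod_pow]
  have hunit : IsUnit (Matrix.diagonal (fun j : Fin n => σ j.succ ^ 2)).det := by
    rw [hdet, isUnit_iff_ne_zero]
    exact pow_ne_zero _ (Finset.prod_ne_zero_iff.2 fun i _ => hσ0 _)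
  rw [h, Matrix.det_add_replicateCol_mul_replicateRow hunit, hdet, Matrix.det_unique]
  have hinv : (Matrix.diagonal (fun j : Fin n => σ j.succ ^ 2))⁻¹ =
      Matrix.diagonal fun j => (σ j.succ ^ 2)⁻¹ := by
    refine Matrix.inv_eq_right_inv ?_
    rw [Matrix.diagonal_mul_diagonal]
    simp [hσ0]
  rw [hinv, Fin.prod_univ_succ, Fin.sum_univ_succ]
  simp only [Matrix.add_apply, Matrix.one_apply_eq, Matrix.mul_apply,
    Matrix.replicateRow_apply, Matrix.replicateCol_apply, Matrix.diagonal_apply, mul_ite, mul_zero,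
    Finset.sum_ite_eq', Finset.mem_univ, if_true]
  have hs : ∑ j : Fin n, σ 0 * (σ j.succ ^ 2)⁻¹ * σ 0 = σ 0 ^ 2 * ∑ j : Fin n, 1 / σ j.succ ^ 2 := by
    rw [Finset.mul_sum]
    exact Finset.sum_congr rfl fun j _ => by ring
  rw [hs]
  have := hσ0 0
  field_simp

/-- Moments of the volume of a weighted standard Gaussian simplex. -/
lemma lintegral_volume_gaussianSimplex_rpow {E : Type*} [NormedAddCommGroup E]
    [InnerProductSpace ℝ E] [FiniteDimensional ℝ E] [MeasurableSpace E] [BorelSpace E]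
    (l : ℕ) (hl : l ≤ Module.finrank ℝ E) (σ : Fin (l + 1) → ℝ) (hσ : ∀ i, 0 < σ i)
    (p : ℝ) (hp : 0 < p) :
    ∫⁻ x : Fin (l + 1) → E, ENNReal.ofReal
        ((√(Matrix.gram ℝ fun j : Fin l => σ j.succ • x j.succ - σ 0 • x 0).det / (l ! : ℝ)) ^ p)
        ∂(Measure.pi fun _ => stdGaussian E) =
      ENNReal.ofReal (((2 : ℝ) ^ ((l : ℝ) / 2) * (∏ i, σ i) / (l ! : ℝ) *
        √(∑ i, 1 / σ i ^ 2)) ^ p *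
        ∏ i ∈ Finset.Icc (Module.finrank ℝ E - l + 1) (Module.finrank ℝ E),
          Real.Gamma (((i : ℝ) + p) / 2) / Real.Gamma ((i : ℝ) / 2)) := by
  have hprod : 0 < ∏ i, σ i := Finset.prod_pos fun i _ => hσ i
  have hsum : 0 < ∑ i, 1 / σ i ^ 2 :=
    Finset.sum_pos (fun i _ => by have := hσ i; positivity) Finset.univ_nonempty
  have hdet := det_transpose_mul_edgeMatrix σ hσ
  simp_rw [← sum_edgeMatrix_smul]
  rw [lintegral_det_gram_sum_smul_pi_stdGaussian (edgeMatrix σ) (by rw [hdet]; positivity)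
    (F := fun t => ENNReal.ofReal ((√t / (l ! : ℝ)) ^ p)) (by fun_prop), hdet]
  have hpt : ∀ w : Fin l → E, ENNReal.ofReal
      ((√((∏ i, σ i) ^ 2 * (∑ i, 1 / σ i ^ 2) * (Matrix.gram ℝ w).det) / (l ! : ℝ)) ^ p) =
      ENNReal.ofReal (((∏ i, σ i) / (l ! : ℝ) * √(∑ i, 1 / σ i ^ 2)) ^ p) *
        ENNReal.ofReal (√(Matrix.gram ℝ w).det ^ p) := by
    intro w
    rw [← ENNReal.ofReal_mul (by positivity), ← Real.mul_rpow (by positivity) (by positivity),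
      Real.sqrt_mul (by positivity), Real.sqrt_mul (by positivity), Real.sqrt_sq hprod.le]
    congr 2
    ring
  simp_rw [hpt]
  have hΓ : ∀ i ∈ Finset.Icc (Module.finrank ℝ E - l + 1) (Module.finrank ℝ E),
      0 ≤ (2 : ℝ) ^ (p / 2) * (Real.Gamma (((i : ℝ) + p) / 2) / Real.Gamma ((i : ℝ) / 2)) := by
    intro i hi
    have := Real.Gamma_nonneg_of_nonneg (s := ((i : ℝ) + p) / 2) (by positivity)
    have := Real.Gamma_nonneg_of_nonneg (s := (i : ℝ) / 2) (by positivity)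
    positivity
  rw [lintegral_const_mul _
    (((continuous_det_gram.measurable.sqrt).pow_const p).ennreal_ofReal),
    lintegral_sqrt_det_gram_rpow_pi_stdGaussian p hp l E hl, ← ENNReal.ofReal_prod_of_nonneg hΓ,
    ← ENNReal.ofReal_mul (by positivity), Finset.prod_mul_distrib, Finset.prod_const, Nat.card_Icc,
    show Module.finrank ℝ E + 1 - (Module.finrank ℝ E - l + 1) = l by omega, ← mul_assoc]
  congr 2
  rw [← Real.rpow_mul_natCast (by norm_num), show p / 2 * (l : ℝ) = l / 2 * p by ring,
    Real.rpow_mul (by norm_num), ← Real.mul_rpow (by positivity) (by positivity)]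
  congr 1
  ring

theorem theorem6p1 {Ω : Type*} [MeasurableSpace Ω] (P : Measure Ω) [IsProbabilityMeasure P]
    (d l : ℕ) (hl : 1 ≤ l) (hld : l ≤ d)
    (X : Fin (l + 1) → Ω → EuclideanSpace ℝ (Fin d))
    (hX : ∀ i, HasLaw (X i) (stdGaussian (EuclideanSpace ℝ (Fin d))) P)
    (hindep : iIndepFun X P)
    (σ : Fin (l + 1) → ℝ) (hσ : ∀ i, 0 < σ i)
    (p : ℝ) (hp : 0 < p) :
    (∀ ω, μHE[l] (convexHull ℝ (Set.range fun i => σ i • X i ω)) < ⊤) ∧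
    Integrable (fun ω => (μHE[l]).real (convexHull ℝ (Set.range fun i => σ i • X i ω)) ^ p) P ∧
    ∫ ω, (μHE[l]).real (convexHull ℝ (Set.range fun i => σ i • X i ω)) ^ p ∂P =
      ((2 : ℝ) ^ ((l : ℝ) / 2) * (∏ i, σ i) / (l ! : ℝ) * √(∑ i, 1 / σ i ^ 2)) ^ p *
        ∏ i ∈ Finset.Icc (d - l + 1) d,
          Real.Gamma (((i : ℝ) + p) / 2) / Real.Gamma ((i : ℝ) / 2) := by
  let f : (Fin (l + 1) → EuclideanSpace ℝ (Fin d)) → ℝ := fun x =>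
    (√(Matrix.gram ℝ fun j : Fin l => σ j.succ • x j.succ - σ 0 • x 0).det / (l ! : ℝ)) ^ p
  have hf0 : ∀ x, 0 ≤ f x := fun x => by positivity
  have hfm : Measurable f := by
    refine Measurable.pow_const (Measurable.div_const (Measurable.sqrt ?_) _) p
    exact (continuous_det_gram.comp (f := fun (x : Fin (l + 1) → EuclideanSpace ℝ (Fin d))
      (j : Fin l) => σ j.succ • x j.succ - σ 0 • x 0) (by fun_prop)).measurable
  have hlaw := hindep.hasLaw_pi hX
  have hvol : ∀ ω, (μHE[l]).real (convexHull ℝ (Set.range fun i => σ i • X i ω)) ^ p =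
      f fun i => X i ω := by
    intro ω
    rw [measureReal_def, euclideanHausdorffMeasure_convexHull_range,
      ENNReal.toReal_ofReal (by positivity)]
  have hlint := lintegral_volume_gaussianSimplex_rpow (E := EuclideanSpace ℝ (Fin d)) l
    (by simpa using hld) σ hσ p hp
  rw [finrank_euclideanSpace_fin] at hlint
  have hint : Integrable f (Measure.pi fun _ => stdGaussian (EuclideanSpace ℝ (Fin d))) := by
    refine ⟨hfm.aestronglyMeasurable, ?_⟩
    rw [hasFiniteIntegral_iff_ofReal (.of_forall hf0), hlint]
    exact ENNReal.ofReal_lt_top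
  simp_rw [hvol]
  refine ⟨fun ω => ?_, ?_, ?_⟩
  · rw [euclideanHausdorffMeasure_convexHull_range]
    exact ENNReal.ofReal_lt_top
  · rw [← hlaw.map_eq] at hint
    exact hint.comp_aemeasurable hlaw.aemeasurable
  · have h := hlaw.integral_comp (f := f) hfm.aestronglyMeasurable
    refine h.trans ?_
    rw [integral_eq_lintegral_of_nonneg_ae (.of_forall hf0) hfm.aestronglyMeasurable, hlint,
      ENNReal.toReal_ofReal]
    refine mul_nonneg ?_ (Finset.prod_nonneg fun i _ => div_nonneg ?_ ?_)
    · have := Finset.prod_nonneg fun i (_ : i ∈ Finset.univ) => (hσ i).le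
      positivity
    · exact Real.Gamma_nonneg_of_nonneg (by positivity)
    · exact Real.Gamma_nonneg_of_nonneg (by positivity)
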